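/- Let $d\ge 2$, let $\Theta\subset\mathbb R^m$ be compact and convex, let $f,g:\mathbb R^m\times\mathbb R^d\to\mathbb R$, and put $\mathcal S(\theta)=\arg\min_{x\in\mathbb R^d}g(\theta,x)$. All norms are Euclidean. **PL° condition.** Let $\mu>0$. A $\mathcal C^2$ function $h:\mathbb R^d\to\mathbb R$ with set of local minimizers $\mathcal M$ satisfies PL° with constant $\mu$ if $\mathcal M$ is contained in a compact set and every connected component $\mathcal M'$ of $\mathcal M$ has an open neighbourhood $\mathcal N(\mathcal M')\supseteq\mathcal M'$ such that 1. for every $\mathcal M'$, $h$ is $\mathcal C^4$ on $\mathcal N(\mathcal M')$ and $h(x)-\min_{\mathcal N(\mathcal M')}h\le\frac1{2\mu}\|\nabla h(x)\|^2$ for all $x\in\mathcal N(\mathcal M')$; 2. if $x\notin\bigcup_{\mathcal M'}\mathcal N(\mathcal M')$ and $\nabla h(x)=0$, then $\nabla^2h(x)$ is negative definite. **Assumptions.** For constants $\mu>0$ and $L_{f,1},L_{g,2}\ge 0$: - For every $\theta\in\Theta$, $g(\theta,\cdot)$ satisfies PL° with constant $\mu$. - $f$ is $\mathcal C^1$ near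 every point of $\Theta\times\mathbb R^d$; on $\Theta\times\mathbb R^d$ it is $L_{f,1}$-Lipschitz in $(\theta,x)$ and its gradient in $(\theta,x)$ is Lipschitz. There are $C_f,D_f\ge0$ and an integer $n_f\ge1$ with $|f(\theta,x)|\le C_f\|x\|^{n_f}+D_f$ for all $\theta\in\Theta$, $x\in\mathbb R^d$. - $g$ is $\mathcal C^2$ near every point of $\Theta\times\mathbb R^d$, and $\partial_x^2g$ is continuous on $\Theta\times\mathbb R^d$. There are $C_g,D_g\ge0$ and an integer $n_g\ge1$ with $\|\partial_\theta g(\theta,x)\|\le C_g\|x\|^{n_g}+D_g$ for all $\theta\in\Theta$, $x\in\mathbb R^d$. - For every $x\in\bigcup_{\theta\in\Theta}\mathcal S(\theta)$ and all $\theta_1,\theta_2\in\Theta$, $\|\partial_xg(\theta_1,x)-\partial_xg(\theta_2,x)\|\le L_{g,2}\|\theta_1-\theta_2\|$ (in particular this holds if it is true for every $x\in\mathbb R^d$). - $\mathcal S(\theta)\neq\emptyset$ for every $\theta\in\Theta$, and there are $\mu_{\mathrm{qg}},\mathsf D>0$ such that for every $\theta\in\Theta$: $\mathcal S(\theta)\subseteq\{x:\|x\|\le\mathsf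 D\}$, and $\frac{\mu_{\mathrm{qg}}}2\,\mathrm{dist}^2(x,\mathcal S(\theta))\le g(\theta,x)-\min_zg(\theta,z)$ whenever $\|x\|\ge\mathsf D$. **Conclusion.** For every $\theta\in\Theta$ the maximum $F_{\max}(\theta)=\max_{x\in\mathcal S(\theta)}f(\theta,x)$ is attained, and $$|F_{\max}(\theta_1)-F_{\max}(\theta_2)|\le L_{f,1}\Bigl(1+\frac{L_{g,2}}{\mu}\Bigr)\|\theta_1-\theta_2\|\qquad\text{for all }\theta_1,\theta_2\in\Theta .$$ -/

import Mathlib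

open scoped NNReal

noncomputable section

namespace Bilevel

/-- The set of all local minimizers of `h`. -/
def localMinima {d : ℕ} (h : EuclideanSpace ℝ (Fin d) → ℝ) :
    Set (EuclideanSpace ℝ (Fin d)) :=
  {x | IsLocalMin h x}

/-- `U` is an open neighbourhood of the set `C` on which `h` satisfies the Polyak–Łojasiewicz
inequality with constant `μ`, relative to the minimum of `h` over `U`. (The bound is written
against every value `h z`, `z ∈ U`; if `C` is a nonempty set of local minimizers, then taking
`x ∈ C` shows that the minimum over `U` is attained, so this is the bound against the minimum.) -/
def IsPLNhd {d : ℕ} (μ : ℝ) (h : EuclideanSpace ℝ (Fin d) → ℝ)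
    (C U : Set (EuclideanSpace ℝ (Fin d))) : Prop :=
  IsOpen U ∧ C ⊆ U ∧ ∀ x ∈ U, ∀ z ∈ U, h x - h z ≤ (2 * μ)⁻¹ * ‖gradient h x‖ ^ 2

/-- The PL° condition with constant `μ`. Here `N C` is the neighbourhood attached to a connected
component `C` of the set of local minimizers. -/
def PLCirc {d : ℕ} (μ : ℝ) (h : EuclideanSpace ℝ (Fin d) → ℝ) : Prop :=
  0 < μ ∧ ContDiff ℝ 2 h ∧
  (∃ N : Set (EuclideanSpace ℝ (Fin d)) → Set (EuclideanSpace ℝ (Fin d)),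
    (∀ a ∈ localMinima h,
      IsPLNhd μ h (connectedComponentIn (localMinima h) a)
          (N (connectedComponentIn (localMinima h) a)) ∧
        ContDiffOn ℝ 4 h (N (connectedComponentIn (localMinima h) a))) ∧
    (∀ x, x ∉ ⋃ a ∈ localMinima h, N (connectedComponentIn (localMinima h) a) →
      gradient h x = 0 →
        ∀ v : EuclideanSpace ℝ (Fin d), v ≠ 0 → fderiv ℝ (fderiv ℝ h) x v v < 0)) ∧
  ∃ K : Set (EuclideanSpace ℝ (Fin d)), IsCompact K ∧ localMinima h ⊆ K

/-- The solution set `S(θ) = argmin_x g(θ, x)`. -/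
def solSet {m d : ℕ} (g : EuclideanSpace ℝ (Fin m) → EuclideanSpace ℝ (Fin d) → ℝ)
    (θ : EuclideanSpace ℝ (Fin m)) : Set (EuclideanSpace ℝ (Fin d)) :=
  {x | ∀ z, g θ x ≤ g θ z}

/-- The pessimistic hyper-objective `F_max(θ) = max_{x ∈ S(θ)} f(θ, x)`. -/
def Fmax {m d : ℕ} (f g : EuclideanSpace ℝ (Fin m) → EuclideanSpace ℝ (Fin d) → ℝ)
    (θ : EuclideanSpace ℝ (Fin m)) : ℝ :=
  sSup (f θ '' solSet g θ)

/-- A function of two variables, regarded as a function on the Euclidean product space. -/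
def joint {m d : ℕ} (h : EuclideanSpace ℝ (Fin m) → EuclideanSpace ℝ (Fin d) → ℝ) :
    WithLp 2 (EuclideanSpace ℝ (Fin m) × EuclideanSpace ℝ (Fin d)) → ℝ :=
  fun p => h p.fst p.snd

/-- The region `Θ × ℝᵈ` in the Euclidean product space. -/
def cyl {m : ℕ} (d : ℕ) (Θ : Set (EuclideanSpace ℝ (Fin m))) :
    Set (WithLp 2 (EuclideanSpace ℝ (Fin m) × EuclideanSpace ℝ (Fin d))) :=
  {p | p.fst ∈ Θ}

/-- The regularity assumptions on the upper-level objective `f`. -/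
structure UpperRegular {m d : ℕ} (Θ : Set (EuclideanSpace ℝ (Fin m)))
    (f : EuclideanSpace ℝ (Fin m) → EuclideanSpace ℝ (Fin d) → ℝ) (Lf1 : ℝ≥0) : Prop where
  contDiff : ∀ p ∈ cyl d Θ, ContDiffAt ℝ 1 (joint f) p
  lipschitz : LipschitzOnWith Lf1 (joint f) (cyl d Θ)
  smooth : ∃ Lf2 : ℝ≥0, LipschitzOnWith Lf2 (gradient (joint f)) (cyl d Θ)
  growth : ∃ (C D : ℝ) (n : ℕ), 0 ≤ C ∧ 0 ≤ D ∧ 1 ≤ n ∧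
    ∀ θ ∈ Θ, ∀ x, |f θ x| ≤ C * ‖x‖ ^ n + D

/-- The regularity assumptions on the lower-level objective `g`. The smoothness constant `Lg2`
controls how the gradient `∂ₓ g(·, x)` varies with `θ`; this is only required at points `x` that
minimize `g(θ', ·)` for some `θ' ∈ Θ`. -/
structure LowerRegular {m d : ℕ} (Θ : Set (EuclideanSpace ℝ (Fin m)))
    (g : EuclideanSpace ℝ (Fin m) → EuclideanSpace ℝ (Fin d) → ℝ) (Lg2 : ℝ≥0) : Prop where
  contDiff : ∀ p ∈ cyl d Θ, ContDiffAt ℝ 2 (joint g) p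
  smooth : ∀ θ' ∈ Θ, ∀ x ∈ solSet g θ', LipschitzOnWith Lg2 (fun θ => gradient (g θ) x) Θ
  growth : ∃ (C D : ℝ) (n : ℕ), 0 ≤ C ∧ 0 ≤ D ∧ 1 ≤ n ∧
    ∀ θ ∈ Θ, ∀ x, ‖gradient (fun η => g η x) θ‖ ≤ C * ‖x‖ ^ n + D
  hessian_continuous : ContinuousOn
    (fun p : EuclideanSpace ℝ (Fin m) × EuclideanSpace ℝ (Fin d) =>
      fderiv ℝ (fderiv ℝ (g p.1)) p.2) (Θ ×ˢ Set.univ)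
  min_attained : ∀ θ ∈ Θ, (solSet g θ).Nonempty
  quadratic_growth : ∃ (μqg D : ℝ), 0 < μqg ∧ 0 < D ∧ ∀ θ ∈ Θ,
    solSet g θ ⊆ Metric.closedBall 0 D ∧
    ∀ x, D ≤ ‖x‖ → ∀ z ∈ solSet g θ,
      μqg * Metric.infDist x (solSet g θ) ^ 2 / 2 ≤ g θ x - g θ z

end Bilevel

end

open Filter Topology Set
open scoped NNReal

/-! A minimizer `y` of `g θ` has gradient at most `Lg2 * ‖η - θ‖` for `g η`. An error bound `μ *
dist(y, S(η)) ≤ ‖∇(g η) y‖` would therefore place a point of `S(η)` within `Lg2 / μ * ‖η - θ‖` of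
`y`, and the Lipschitz bound on `f` would compare the two maxima. But PL° is local, so the error
bound is available only once `y` is known to be close to `S(η)`.

The sharp constant: PL near a minimizer gives quadratic growth (`eventually_quadratic_growth`), so
the Hessian at the minimizer `p` nearest to `y` has curvature at least `μ` in the direction `y - p`.
Continuity of the Hessian costs an `ε` (`mul_norm_sub_le_norm_fderiv`, `exists_local_error_bound`).

Closeness comes from connectedness of `S(θ)`. The critical points that are not local minimizers are
countable, so for `d ≥ 2` their complement is path connected, and gradient descent retracts it,
sublevel set by sublevel set, onto the local minimizers (`isPreconnected_localMin`). These form a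
connected set on which `g θ` is constant, so all are global. By the error bound, "`S(η)` approaches
`x`" is a locally constant property of `x ∈ S(θ)`; it holds at a limit of minimizers, hence on all
of `S(θ)` (`tendsto_infDist_solSet`).

This yields a pointwise Lipschitz estimate with `μ - ε` in place of `μ`, which is propagated along
segments of `Θ` before letting `ε → 0`. -/

namespace Bilevel

/-! ### From the PL inequality to an error bound -/

section NormedSpace

variable {E : Type*} [NormedAddCommGroup E] [NormedSpace ℝ E]

/-- If `φ + c ‖· - z‖` has a local minimum at `z`, then the derivative of `φ` at `z` is at most `c`
in norm. -/
theorem norm_fderiv_le_of_eventually_sub_le {φ : E → ℝ} {φ' : E →L[ℝ] ℝ} {z : E} {c : ℝ}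
    (hc : 0 ≤ c) (hφ : HasFDerivAt φ φ' z) (h : ∀ᶠ x in 𝓝 z, φ z - c * ‖x - z‖ ≤ φ x) :
    ‖φ'‖ ≤ c := by
  refine le_of_forall_pos_le_add fun ε hε => ?_
  have h1 := (hasFDerivAt_iff_isLittleO_nhds_zero.1 hφ).def hε
  have h2 : ∀ᶠ v in 𝓝 (0 : E), φ z - c * ‖v‖ ≤ φ (z + v) := by
    have : Tendsto (fun v : E => z + v) (𝓝 0) (𝓝 z) := by
      simpa using (tendsto_const_nhds (x := z)).add (tendsto_id (x := 𝓝 (0 : E)))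
    simpa using this.eventually h
  have h3 : ∀ᶠ v in 𝓝 (0 : E), -((c + ε) * ‖v‖) ≤ φ' v := by
    filter_upwards [h1, h2] with v h1 h2
    have := (abs_le.1 (Real.norm_eq_abs _ ▸ h1)).2
    linarith
  have h4 : ∀ᶠ v in 𝓝 (0 : E), -((c + ε) * ‖v‖) ≤ φ' (-v) := by
    have : Tendsto (fun v : E => -v) (𝓝 0) (𝓝 0) := by
      simpa using (tendsto_id (x := 𝓝 (0 : E))).neg
    simpa using this.eventually h3
  refine ContinuousLinearMap.opNorm_le_of_nhds_zero (by positivity) ?_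
  filter_upwards [h3, h4] with v h3 h4
  rw [Real.norm_eq_abs, abs_le]
  rw [map_neg] at h4
  constructor <;> linarith

/-- The Polyak–Łojasiewicz inequality near a minimizer implies quadratic growth near it. -/
theorem eventually_quadratic_growth [ProperSpace E] {h : E → ℝ} (hh : Differentiable ℝ h)
    {μ ν : ℝ} (hν : 0 < ν) (hνμ : ν < μ) {S : Set E} (hS : S = {x | ∀ z, h x ≤ h z}) {p : E}
    (hp : p ∈ S)
    (hPL : ∀ᶠ x in 𝓝 p, h x - h p ≤ (2 * μ)⁻¹ * ‖fderiv ℝ h x‖ ^ 2) :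
    ∀ᶠ y in 𝓝 p, ν / 2 * Metric.infDist y S ^ 2 ≤ h y - h p := by
  have hμ : 0 < μ := hν.trans hνμ
  have hmin : ∀ z, h p ≤ h z := by rw [hS] at hp; exact hp
  obtain ⟨R, hR, hball⟩ := Metric.eventually_nhds_iff.1 hPL
  -- Off `S`, PL bounds the derivative of `√(h - h p)` below by `√(μ / 2) > c`. Hence a minimizer of
  -- `√(h - h p) + c * ‖· - y‖` interior to the ball must lie in `S`.
  set c := √(ν / 2) with hc
  have hc0 : 0 < c := Real.sqrt_pos.2 (by positivity)
  have hc2 : c ^ 2 = ν / 2 := Real.sq_sqrt (by positivity)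
  have hcont : Continuous fun x => √(h x - h p) := (hh.continuous.sub continuous_const).sqrt
  have hev : ∀ᶠ y in 𝓝 p, √(h y - h p) < c * (R / 2) := by
    refine hcont.continuousAt.eventually_lt continuousAt_const ?_
    simp only [sub_self, Real.sqrt_zero]
    positivity
  filter_upwards [hev, Metric.ball_mem_nhds p (half_pos hR)] with y hy hyp
  obtain ⟨z, hz, hzmin⟩ := (isCompact_closedBall y (R / 2)).exists_isMinOn
    (Metric.nonempty_closedBall.2 (half_pos hR).le)
    (f := fun z => √(h z - h p) + c * ‖z - y‖)
    (hcont.add (continuous_const.mul (continuous_id.sub continuous_const).norm)).continuousOn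
  have hzy : √(h z - h p) + c * ‖z - y‖ ≤ √(h y - h p) := by
    simpa using hzmin (Metric.mem_closedBall_self (half_pos hR).le)
  have hlt : ‖z - y‖ < R / 2 := by
    have := Real.sqrt_nonneg (h z - h p)
    nlinarith
  have hzS : z ∈ S := by
    by_contra hzS
    have hpos : 0 < h z - h p := by
      rw [hS] at hzS
      simp only [mem_ofPred_eq, not_forall, not_le] at hzS
      obtain ⟨w, hw⟩ := hzS
      linarith [hmin w]
    have hd : HasFDerivAt (fun x => √(h x - h p)) ((1 / (2 * √(h z - h p))) • fderiv ℝ h z) z :=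
      ((hh z).hasFDerivAt.sub_const (h p)).sqrt hpos.ne'
    have hle := norm_fderiv_le_of_eventually_sub_le hc0.le hd (by
      have : Metric.closedBall y (R / 2) ∈ 𝓝 z :=
        mem_of_superset (Metric.isOpen_ball.mem_nhds (by simpa [dist_eq_norm] using hlt))
          Metric.ball_subset_closedBall
      filter_upwards [this] with x hx
      have h1 : √(h z - h p) + c * ‖z - y‖ ≤ √(h x - h p) + c * ‖x - y‖ := hzmin hx
      have h2 : ‖x - y‖ ≤ ‖x - z‖ + ‖z - y‖ := norm_sub_le_norm_sub_add_norm_sub _ _ _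
      nlinarith)
    have hs : 0 < √(h z - h p) := Real.sqrt_pos.2 hpos
    rw [norm_smul, Real.norm_of_nonneg (by positivity), div_mul_eq_mul_div, one_mul,
      div_le_iff₀ (by positivity)] at hle
    have hPLz := hball (y := z) (by
      have := dist_triangle z y p
      rw [dist_eq_norm z y] at this
      rw [Metric.mem_ball] at hyp
      linarith)
    have hsq : √(h z - h p) ^ 2 = h z - h p := Real.sq_sqrt hpos.le
    have h5 : ‖fderiv ℝ h z‖ ^ 2 ≤ (c * (2 * √(h z - h p))) ^ 2 :=
      pow_le_pow_left₀ (norm_nonneg _) hle 2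
    rw [inv_mul_eq_div, le_div_iff₀ (by positivity)] at hPLz
    have h6 : (c * (2 * √(h z - h p))) ^ 2 = 2 * ν * (h z - h p) := by
      rw [mul_pow, mul_pow, hc2, hsq]; ring
    nlinarith
  have h7 : c * Metric.infDist y S ≤ √(h y - h p) := by
    have := Metric.infDist_le_dist_of_mem (x := y) hzS
    rw [dist_comm, dist_eq_norm] at this
    have := Real.sqrt_nonneg (h z - h p)
    nlinarith
  have h8 := pow_le_pow_left₀ (mul_nonneg hc0.le Metric.infDist_nonneg) h7 2
  rwa [mul_pow, hc2, Real.sq_sqrt (sub_nonneg.2 (hmin y))] at h8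

/-- Second-order necessary condition extracted from quadratic growth along a ray. -/
theorem le_second_fderiv_of_eventually_growth {h : E → ℝ} (hh : ContDiff ℝ 2 h) {p w : E} {κ : ℝ}
    (hp : fderiv ℝ h p = 0)
    (hg : ∀ᶠ t in 𝓝[>] (0 : ℝ), κ / 2 * t ^ 2 ≤ h (p + t • w) - h p) :
    κ ≤ fderiv ℝ (fderiv ℝ h) p w w := by
  -- A second derivative below `β < κ` forces slope at most `β * t` along the ray; integrating gives
  -- growth at most `β / 2 * t ^ 2`.
  by_contra! hlt
  obtain ⟨β, hβ1, hβ2⟩ := exists_between hlt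
  have hd : Differentiable ℝ h := hh.differentiable (by norm_num)
  have hd2 : Differentiable ℝ (fderiv ℝ h) :=
    (hh.fderiv_right (m := 1) (by norm_num)).differentiable (by norm_num)
  have hline : ∀ t : ℝ, HasDerivAt (fun t : ℝ => p + t • w) w t := fun t => by
    simpa using ((hasDerivAt_id t).smul_const w).const_add p
  have hk : ∀ t : ℝ, HasDerivAt (fun t : ℝ => h (p + t • w)) (fderiv ℝ h (p + t • w) w) t :=
    fun t => (hd _).hasFDerivAt.comp_hasDerivAt t (hline t)
  have hk2 : HasDerivAt (fun t : ℝ => fderiv ℝ h (p + t • w) w)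
      (fderiv ℝ (fderiv ℝ h) p w w) 0 := by
    have h1 : HasDerivAt (fun t : ℝ => fderiv ℝ h (p + t • w)) (fderiv ℝ (fderiv ℝ h) p w) 0 := by
      have := (hd2 (p + (0 : ℝ) • w)).hasFDerivAt.comp_hasDerivAt (0 : ℝ) (hline 0)
      rw [zero_smul, add_zero] at this
      exact this
    simpa using h1.clm_apply (hasDerivAt_const (0 : ℝ) w)
  have hsl : ∀ᶠ t in 𝓝[>] (0 : ℝ), fderiv ℝ h (p + t • w) w ≤ β * t := by
    have h1 := (hasDerivAt_iff_tendsto_slope.1 hk2).mono_left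
      (nhdsWithin_mono (0 : ℝ) (fun t (ht : 0 < t) => ht.ne'))
    filter_upwards [h1.eventually_lt_const hβ1, self_mem_nhdsWithin] with t ht ht0
    rw [mem_Ioi] at ht0
    simp only [slope_def_field, zero_smul, add_zero, hp, zero_apply,
      sub_zero] at ht
    rw [div_lt_iff₀ ht0] at ht
    exact ht.le
  obtain ⟨u, hu, hsub⟩ := mem_nhdsGT_iff_exists_Ioc_subset.1 (hsl.and hg)
  rw [mem_Ioi] at hu
  have hle : h (p + u • w) ≤ β / 2 * u ^ 2 + h p := by
    refine image_le_of_deriv_right_le_deriv_boundary (a := 0) (b := u)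
      (f := fun t : ℝ => h (p + t • w)) (f' := fun t => fderiv ℝ h (p + t • w) w)
      (B := fun t => β / 2 * t ^ 2 + h p) (B' := fun t => β * t)
      (fun t _ => (hk t).continuousAt.continuousWithinAt) (fun t _ => (hk t).hasDerivWithinAt)
      (by simp) (by fun_prop) (fun t _ => ?_) (fun t ht => ?_) ⟨hu.le, le_rfl⟩
    · have := (((hasDerivAt_id t).pow 2).const_mul (β / 2)).add_const (h p)
      refine (this.congr_deriv ?_).hasDerivWithinAt
      simp; ring
    · rcases ht.1.eq_or_lt with h0 | h0
      · simp [← h0, hp]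
      · exact (hsub ⟨h0, ht.2.le⟩).1
  have := (hsub ⟨hu, le_rfl⟩).2
  have hu2 : 0 < u ^ 2 := by positivity
  nlinarith

/-- Error bound: near a minimizer `p` of `h` closest to `y`, the distance of `y` to the set of
minimizers is controlled by the derivative of `h` at `y`. -/
theorem mul_norm_sub_le_norm_fderiv [ProperSpace E] {h : E → ℝ} (hh : ContDiff ℝ 2 h)
    {μ ε : ℝ} (hμ : 0 < μ) {S : Set E} (hS : S = {x | ∀ z, h x ≤ h z}) {p y : E} (hp : p ∈ S)
    (hPL : ∀ᶠ x in 𝓝 p, h x - h p ≤ (2 * μ)⁻¹ * ‖fderiv ℝ h x‖ ^ 2)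
    (hy : Metric.infDist y S = ‖y - p‖) {s : Set E} (hs : Convex ℝ s) (hps : p ∈ s) (hys : y ∈ s)
    (hε : ∀ z ∈ s, ‖fderiv ℝ (fderiv ℝ h) z - fderiv ℝ (fderiv ℝ h) p‖ ≤ ε) :
    (μ - ε) * ‖y - p‖ ≤ ‖fderiv ℝ h y‖ := by
  set w := y - p with hw
  have hd : Differentiable ℝ h := hh.differentiable (by norm_num)
  have hd2 : Differentiable ℝ (fderiv ℝ h) :=
    (hh.fderiv_right (m := 1) (by norm_num)).differentiable (by norm_num)
  have hmin : ∀ z, h p ≤ h z := by rw [hS] at hp; exact hp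
  have hp0 : fderiv ℝ h p = 0 :=
    IsLocalMin.fderiv_eq_zero (Eventually.of_forall hmin)
  -- As `p` is a point of `S` nearest to `y`, the point `p + t • w` is still at distance at least `t
  -- * ‖w‖` from `S`, so growth in the distance becomes growth in `t`.
  have hH : μ * ‖w‖ ^ 2 ≤ fderiv ℝ (fderiv ℝ h) p w w := by
    have key : ∀ ν ∈ Ioo 0 μ, ν * ‖w‖ ^ 2 ≤ fderiv ℝ (fderiv ℝ h) p w w := by
      intro ν hν
      refine le_second_fderiv_of_eventually_growth hh hp0 ?_
      have hq := eventually_quadratic_growth hd hν.1 hν.2 hS hp hPL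
      have ht : Tendsto (fun t : ℝ => p + t • w) (𝓝[>] 0) (𝓝 p) := by
        have : Continuous fun t : ℝ => p + t • w := by fun_prop
        simpa using (this.tendsto 0).mono_left nhdsWithin_le_nhds
      filter_upwards [ht.eventually hq, Ioc_mem_nhdsGT (zero_lt_one' ℝ)] with t hqt ht01
      have h1 : t * ‖w‖ ≤ Metric.infDist (p + t • w) S := by
        have h2 := Metric.infDist_le_infDist_add_dist (s := S) (x := y) (y := p + t • w)
        have h3 : y - (p + t • w) = (1 - t) • w := by
          rw [sub_smul, one_smul, hw]; abel
        rw [hy, dist_eq_norm, h3, norm_smul, Real.norm_of_nonneg (by linarith [ht01.2])] at h2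
        linarith
      have h4 := pow_le_pow_left₀ (mul_nonneg ht01.1.le (norm_nonneg w)) h1 2
      have h5 := mul_le_mul_of_nonneg_left h4 (half_pos hν.1).le
      calc ν * ‖w‖ ^ 2 / 2 * t ^ 2 = ν / 2 * (t * ‖w‖) ^ 2 := by ring
        _ ≤ _ := h5.trans hqt
    have ht : Tendsto (fun ν : ℝ => ν * ‖w‖ ^ 2) (𝓝[<] μ) (𝓝 (μ * ‖w‖ ^ 2)) := by
      have : Continuous fun ν : ℝ => ν * ‖w‖ ^ 2 := by fun_prop
      exact (this.tendsto μ).mono_left nhdsWithin_le_nhds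
    refine le_of_tendsto ht ?_
    filter_upwards [Ioo_mem_nhdsLT hμ] with ν hν using key ν hν
  have h1 : ‖fderiv ℝ h y - fderiv ℝ h p - fderiv ℝ (fderiv ℝ h) p (y - p)‖ ≤ ε * ‖y - p‖ :=
    hs.norm_image_sub_le_of_norm_fderiv_le' (fun z _ => hd2 z) hε hps hys
  rw [hp0, sub_zero, ← hw] at h1
  rcases eq_or_ne w 0 with h0 | h0
  · simp [h0]
  have hwpos : 0 < ‖w‖ := norm_pos_iff.2 h0
  have h2 := (fderiv ℝ h y - fderiv ℝ (fderiv ℝ h) p w).le_of_opNorm_le h1 w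
  have h3 := (fderiv ℝ h y).le_opNorm w
  rw [Real.norm_eq_abs] at h2 h3
  have h4 := (abs_le.1 h2).1
  have h5 := (le_abs_self _).trans h3
  simp only [sub_apply] at h4
  refine le_of_mul_le_mul_right ?_ hwpos
  nlinarith

end NormedSpace

/-! ### Stable fixed points and limit maps -/

/-- Lyapunov stability of a fixed point under a map whose steps are dominated by the decrease of a
nonnegative function vanishing at that point. -/
theorem eventually_forall_dist_iterate_lt {α : Type*} [PseudoMetricSpace α] {T : α → α} {X : Set α}
    (hX : MapsTo T X X) {φ : α → ℝ} {q : α} (hφ0 : ∀ x, 0 ≤ φ x) (hφ : ContinuousAt φ q)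
    (hq : φ q = 0) (hstep : ∀ᶠ x in 𝓝 q, x ∈ X → dist x (T x) ≤ φ x - φ (T x)) {r : ℝ}
    (hr : 0 < r) : ∀ᶠ y in 𝓝 q, y ∈ X → ∀ k, dist (T^[k] y) q < r := by
  obtain ⟨r₀, hr₀, hstep⟩ := Metric.eventually_nhds_iff.1 hstep
  set ρ := min r r₀ with hρ
  have hρ0 : 0 < ρ := lt_min hr hr₀
  have h1 : ∀ᶠ y in 𝓝 q, φ y < ρ / 2 :=
    hφ.eventually_lt continuousAt_const (by rw [hq]; positivity)
  filter_upwards [h1, Metric.ball_mem_nhds q (half_pos hρ0)] with y hy1 hy2 hyX k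
  rw [Metric.mem_ball] at hy2
  have hball : ∀ z, dist y z ≤ φ y - φ z → dist z q < ρ := fun z hz => by
    have := dist_triangle_left z q y
    linarith [hφ0 z]
  -- The step bounds telescope, and the telescoped bound itself keeps the orbit in the ball where
  -- the next step bound applies.
  have key : dist y (T^[k] y) ≤ φ y - φ (T^[k] y) := by
    induction k with
    | zero => simp
    | succ k ih =>
      have h2 := hstep ((hball _ ih).trans_le (min_le_right _ _)) (hX.iterate k hyX)
      rw [Function.iterate_succ_apply']
      linarith [dist_triangle y (T^[k] y) (T (T^[k] y))]
  exact (hball _ key).trans_le (min_le_left _ _)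

/-- If orbits starting in `D` accumulate at stable fixed points in `M`, then the limit map is a
continuous retraction of `D` to `M`. -/
theorem exists_continuousOn_limit {α : Type*} [MetricSpace α] {T : α → α} (hT : Continuous T)
    {X D M : Set α} (hX : MapsTo T X X) (hD : D ⊆ X) (hfix : ∀ x ∈ M, T x = x)
    (hcl : ∀ x ∈ D, ∃ q ∈ M, MapClusterPt q atTop fun k => T^[k] x)
    (hst : ∀ q ∈ M, ∀ r > 0, ∀ᶠ y in 𝓝 q, y ∈ X → ∀ k, dist (T^[k] y) q < r) :
    ∃ P : α → α, ContinuousOn P D ∧ MapsTo P D M ∧ ∀ x ∈ D, x ∈ M → P x = x := by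
  classical
  choose! P hPM hP using hcl
  refine ⟨P, fun x hx => ?_, hPM, fun x hx hxM => ?_⟩
  · rw [ContinuousWithinAt, Metric.tendsto_nhds]
    intro ε hε
    have h1 := hst (P x) (hPM x hx) (ε / 2) (half_pos hε)
    -- Some iterate of `x` enters the stability neighbourhood of `P x`; by continuity of that one
    -- iterate, so do those of nearby `y`, whose tails then stay near `P x`.
    obtain ⟨k, hk⟩ := (mapClusterPt_iff_frequently.1 (hP x hx) _
      (eventually_eventually_nhds.2 h1)).exists
    have h3 : ∀ᶠ y in 𝓝 x, T^[k] y ∈ X → ∀ j, dist (T^[j] (T^[k] y)) (P x) < ε / 2 :=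
      (hT.iterate k).continuousAt.eventually hk
    filter_upwards [nhdsWithin_le_nhds h3, self_mem_nhdsWithin] with y hy hyD
    have h4 := hy (hX.iterate k (hD hyD))
    have h5 : P y ∈ Metric.closedBall (P x) (ε / 2) := by
      refine Metric.isClosed_closedBall.mem_of_mapClusterPt (hP y hyD) ?_
      filter_upwards [eventually_ge_atTop k] with j hj
      have := h4 (j - k)
      rw [← Function.iterate_add_apply, Nat.sub_add_cancel hj] at this
      exact this.le
    rw [Metric.mem_closedBall] at h5
    linarith
  · have h1 : (fun k => T^[k] x) = fun _ => x := by
      funext k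
      exact Function.iterate_fixed (hfix x hxM) k
    have h2 := hP x hx
    rw [h1] at h2
    exact isClosed_singleton.mem_of_mapClusterPt h2 (Eventually.of_forall fun _ => rfl)

/-! ### Gradient descent and connectedness of local minimizers -/

section GradientDescent

variable {E : Type*} [NormedAddCommGroup E] [InnerProductSpace ℝ E]

/-- One step of gradient descent with step size `η`. -/
noncomputable def gradStep [CompleteSpace E] (h : E → ℝ) (η : ℝ) (x : E) : E := x - η • gradient h x

theorem norm_gradient_eq [CompleteSpace E] (h : E → ℝ) (x : E) :
    ‖gradient h x‖ = ‖fderiv ℝ h x‖ := by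
  simp [gradient]

theorem contDiff_gradient [CompleteSpace E] {h : E → ℝ} (hh : ContDiff ℝ 2 h) :
    ContDiff ℝ 1 (gradient h) :=
  (InnerProductSpace.toDual ℝ E).symm.contDiff.comp (hh.fderiv_right (m := 1) (by norm_num))

/-- Gradient descent with a small step size on a bounded sublevel set. -/
theorem exists_gradStep_descent [FiniteDimensional ℝ E] {h : E → ℝ} (hh : ContDiff ℝ 2 h) {c : ℝ}
    (hb : Bornology.IsBounded {x | h x ≤ c}) :
    ∃ η > 0, (∀ x, h x ≤ c → h (gradStep h η x) + η / 2 * ‖gradient h x‖ ^ 2 ≤ h x) ∧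
      ∀ x y, h x ≤ c → h y ≤ c → ‖η • gradient h x - η • gradient h y‖ ≤ 1 / 2 * ‖x - y‖ := by
  obtain ⟨R, hR⟩ := hb.subset_closedBall (0 : E)
  have hG := contDiff_gradient hh
  obtain ⟨A, hA⟩ := (isCompact_closedBall (0 : E) R).exists_bound_of_continuousOn
    hG.continuous.continuousOn
  obtain ⟨L, hL⟩ := (isCompact_closedBall (0 : E) (R + 1)).exists_bound_of_continuousOn
    (hG.continuous_fderiv (by norm_num)).continuousOn
  have hd : Differentiable ℝ h := hh.differentiable (by norm_num)
  have hGd : Differentiable ℝ (gradient h) := hG.differentiable (by norm_num)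
  have hLip : ∀ x ∈ Metric.closedBall (0 : E) (R + 1), ∀ y ∈ Metric.closedBall (0 : E) (R + 1),
      ‖gradient h x - gradient h y‖ ≤ L * ‖x - y‖ := fun x hx y hy =>
    (convex_closedBall (0 : E) (R + 1)).norm_image_sub_le_of_norm_fderiv_le (fun z _ => hGd z) hL
      hy hx
  -- `η * A ≤ 1` keeps a step from the ball of radius `R` inside radius `R + 1`, where `L` is valid;
  -- `η * L ≤ 1 / 2` gives both the descent and the contraction estimate.
  set η := 1 / (2 * (|L| + |A| + 1)) with hη
  have hden : 0 < 2 * (|L| + |A| + 1) := by positivity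
  have hη0 : 0 < η := by positivity
  have hη1 : η * (2 * (|L| + |A| + 1)) = 1 := by rw [hη]; field_simp
  have hηL : η * L ≤ 1 / 2 := by
    nlinarith [le_abs_self L, abs_nonneg A, mul_nonneg hη0.le (abs_nonneg A),
      mul_le_mul_of_nonneg_left (le_abs_self L) hη0.le]
  have hηA : η * A ≤ 1 := by
    nlinarith [mul_nonneg hη0.le (abs_nonneg A), mul_nonneg hη0.le (abs_nonneg L),
      mul_le_mul_of_nonneg_left (le_abs_self A) hη0.le]
  have hsub : Metric.closedBall (0 : E) R ⊆ Metric.closedBall (0 : E) (R + 1) :=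
    Metric.closedBall_subset_closedBall (by linarith)
  refine ⟨η, hη0, fun x hx => ?_, fun x y hx hy => ?_⟩
  · have hxR := hR hx
    set y := gradStep h η x with hy
    have hyx : y - x = -(η • gradient h x) := by rw [hy, gradStep]; abel
    have hyxn : ‖y - x‖ = η * ‖gradient h x‖ := by
      rw [hyx, norm_neg, norm_smul, Real.norm_of_nonneg hη0.le]
    have hyR : y ∈ Metric.closedBall (0 : E) (R + 1) := by
      rw [mem_closedBall_zero_iff] at hxR ⊢
      have h1 : ‖y‖ ≤ ‖y - x‖ + ‖x‖ := by simpa using norm_add_le (y - x) x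
      have h2 := mul_le_mul_of_nonneg_left (hA x (hR hx)) hη0.le
      linarith
    have hmv : ‖h y - h x - fderiv ℝ h x (y - x)‖ ≤ L * ‖y - x‖ * ‖y - x‖ := by
      refine ((convex_closedBall (0 : E) (R + 1)).inter
        (convex_closedBall x ‖y - x‖)).norm_image_sub_le_of_norm_fderiv_le' (fun z _ => hd z) ?_
        ⟨hsub hxR, Metric.mem_closedBall_self (norm_nonneg _)⟩ ⟨hyR, by simp [dist_eq_norm]⟩
      intro z hz
      have h1 : ‖fderiv ℝ h z - fderiv ℝ h x‖ = ‖gradient h z - gradient h x‖ := by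
        rw [gradient, gradient, ← map_sub, LinearIsometryEquiv.norm_map]
      rw [h1]
      have hL0 : 0 ≤ L := (norm_nonneg _).trans (hL x (hsub hxR))
      have hz2 := hz.2
      rw [Metric.mem_closedBall, dist_eq_norm] at hz2
      exact (hLip z hz.1 x (hsub hxR)).trans (mul_le_mul_of_nonneg_left hz2 hL0)
    have hin : fderiv ℝ h x (y - x) = -(η * ‖gradient h x‖ ^ 2) := by
      rw [hyx, map_neg, map_smul, smul_eq_mul]
      have : fderiv ℝ h x (gradient h x) = inner ℝ (gradient h x) (gradient h x) := by
        conv_rhs => rw [gradient, InnerProductSpace.toDual_symm_apply]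
        rfl
      rw [this, real_inner_self_eq_norm_sq]
    rw [hin, hyxn, Real.norm_eq_abs] at hmv
    have h3 := (abs_le.1 hmv).2
    have h4 : L * (η * ‖gradient h x‖) * (η * ‖gradient h x‖)
        ≤ 1 / 2 * (η * ‖gradient h x‖ ^ 2) := by
      calc _ = (η * L) * (η * ‖gradient h x‖ ^ 2) := by ring
        _ ≤ _ := mul_le_mul_of_nonneg_right hηL (by positivity)
    linarith
  · rw [← smul_sub, norm_smul, Real.norm_of_nonneg hη0.le]
    have h1 := mul_le_mul_of_nonneg_left (hLip x (hsub (hR hx)) y (hsub (hR hy))) hη0.le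
    have h2 := mul_le_mul_of_nonneg_right hηL (norm_nonneg (x - y))
    linarith

variable [FiniteDimensional ℝ E]

theorem gradient_eq_zero_iff (h : E → ℝ) (x : E) : gradient h x = 0 ↔ fderiv ℝ h x = 0 := by
  rw [← norm_eq_zero, norm_gradient_eq, norm_eq_zero]

/-- Near a minimizer satisfying a Polyak–Łojasiewicz inequality, gradient descent is stable. -/
theorem eventually_dist_iterate_gradStep_lt {h : E → ℝ} (hh : Continuous h) {X : Set E} {η K : ℝ}
    (hη : 0 < η) (hK : 0 < K) (hX : MapsTo (gradStep h η) X X)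
    (hdesc : ∀ x ∈ X, h (gradStep h η x) + η / 2 * ‖gradient h x‖ ^ 2 ≤ h x)
    (hT : Continuous (gradStep h η)) {q : E} (hq : gradient h q = 0)
    (hPL : ∀ᶠ x in 𝓝 q, h q ≤ h x ∧ h x - h q ≤ K * ‖gradient h x‖ ^ 2) {r : ℝ} (hr : 0 < r) :
    ∀ᶠ y in 𝓝 q, y ∈ X → ∀ k, dist ((gradStep h η)^[k] y) q < r := by
  have hTq : gradStep h η q = q := by simp [gradStep, hq]
  -- With `a`, `b` the values of `√(h - h q)` before and after a step, descent and PL give `η / 2 *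
  -- G ^ 2 ≤ (a - b) * (a + b) ≤ (a - b) * 2 * √K * G`, whence the factor `4 * √K`.
  refine eventually_forall_dist_iterate_lt (φ := fun x => 4 * √K * √(h x - h q)) hX
    (fun x => by positivity) ?_ (by simp) ?_ hr
  · exact (continuous_const.mul (hh.sub continuous_const).sqrt).continuousAt
  have hPL' : ∀ᶠ x in 𝓝 q, h q ≤ h (gradStep h η x) := by
    have := hT.tendsto q
    rw [hTq] at this
    exact (this.eventually hPL).mono fun x hx => hx.1
  filter_upwards [hPL, hPL'] with x ⟨h1, h2⟩ h3 hx
  have h4 := hdesc x hx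
  have h5 : dist x (gradStep h η x) = η * ‖gradient h x‖ := by
    rw [dist_eq_norm, gradStep, sub_sub_cancel, norm_smul, Real.norm_of_nonneg hη.le]
  rw [h5]
  set G := ‖gradient h x‖
  have hG : 0 ≤ G := norm_nonneg _
  have hk2 : √K ^ 2 = K := Real.sq_sqrt hK.le
  have ha2 : √(h x - h q) ^ 2 = h x - h q := Real.sq_sqrt (sub_nonneg.2 h1)
  have hb2 : √(h (gradStep h η x) - h q) ^ 2 = h (gradStep h η x) - h q :=
    Real.sq_sqrt (sub_nonneg.2 h3)
  have hk : 0 < √K := Real.sqrt_pos.2 hK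
  have ha : 0 ≤ √(h x - h q) := Real.sqrt_nonneg _
  have hb : 0 ≤ √(h (gradStep h η x) - h q) := Real.sqrt_nonneg _
  set k := √K
  set a := √(h x - h q)
  set b := √(h (gradStep h η x) - h q)
  have hba : b ≤ a := by
    refine Real.sqrt_le_sqrt ?_
    have : 0 ≤ η / 2 * G ^ 2 := by positivity
    linarith
  have hak : a ≤ k * G := by
    refine le_of_sq_le_sq ?_ (by positivity)
    rw [mul_pow, hk2, ha2]; exact h2
  rcases hG.eq_or_lt with h0 | h0
  · rw [← h0, mul_zero, ← mul_sub]
    exact mul_nonneg (by positivity) (sub_nonneg.2 hba)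
  refine le_of_mul_le_mul_right ?_ h0
  have h6 : η / 2 * G ^ 2 ≤ (a - b) * (a + b) := by nlinarith
  have h7 : (a - b) * (a + b) ≤ (a - b) * (2 * (k * G)) :=
    mul_le_mul_of_nonneg_left (by linarith) (sub_nonneg.2 hba)
  nlinarith

/-- Orbits of gradient descent on a compact sublevel set accumulate at local minimizers, unless
they start at a critical point that is not a local minimizer. -/
theorem exists_mapClusterPt_gradStep {h : E → ℝ} (hh : Continuous h) {X : Set E} {η : ℝ}
    (hη : 0 < η) (hXc : IsCompact X) (hX : MapsTo (gradStep h η) X X)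
    (hdesc : ∀ x ∈ X, h (gradStep h η x) + η / 2 * ‖gradient h x‖ ^ 2 ≤ h x)
    (hinj : InjOn (gradStep h η) X) (hG : Continuous (gradient h)) {M : Set E}
    (hcrit : ∀ x, gradient h x = 0 → x ∉ M → ∀ᶠ y in 𝓝[≠] x, h y < h x)
    {x : E} (hx : x ∈ X) (hxM : gradient h x = 0 → x ∈ M) :
    ∃ q ∈ M, MapClusterPt q atTop fun k => (gradStep h η)^[k] x := by
  set u : ℕ → E := fun k => (gradStep h η)^[k] x with hu
  have huX : ∀ k, u k ∈ X := fun k => hX.iterate k hx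
  have husucc : ∀ k, u (k + 1) = gradStep h η (u k) := fun k => Function.iterate_succ_apply' _ _ _
  have hstep : ∀ k, h (u (k + 1)) + η / 2 * ‖gradient h (u k)‖ ^ 2 ≤ h (u k) := fun k => by
    rw [husucc]; exact hdesc _ (huX k)
  have hanti : Antitone fun k => h (u k) := antitone_nat_of_succ_le fun k => by
    have : 0 ≤ η / 2 * ‖gradient h (u k)‖ ^ 2 := by positivity
    linarith [hstep k]
  have hbdd : BddBelow (range fun k => h (u k)) :=
    (hXc.bddBelow_image hh.continuousOn).mono 
    (range_subset_iff.2 fun k => mem_image_of_mem h (huX k))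
  have hlim := tendsto_atTop_ciInf hanti hbdd
  set ℓ := ⨅ k, h (u k)
  have hℓ : ∀ k, ℓ ≤ h (u k) := fun k => ciInf_le hbdd k
  have hGlim : Tendsto (fun k => gradient h (u k)) atTop (𝓝 0) := by
    have h1 : Tendsto (fun k => (2 / η) * (h (u k) - h (u (k + 1)))) atTop (𝓝 0) := by
      simpa using (hlim.sub (hlim.comp (tendsto_add_atTop_nat 1))).const_mul (2 / η)
    have h2 : Tendsto (fun k => ‖gradient h (u k)‖ ^ 2) atTop (𝓝 0) := by
      refine squeeze_zero (fun k => by positivity) (fun k => ?_) h1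
      rw [div_mul_eq_mul_div, le_div_iff₀ hη]
      linarith [hstep k]
    have h3 := h2.sqrt
    simp only [Real.sqrt_sq (norm_nonneg _), Real.sqrt_zero] at h3
    exact tendsto_zero_iff_norm_tendsto_zero.2 h3
  obtain ⟨q, -, hq⟩ := hXc.exists_mapClusterPt (f := atTop) (u := u)
    (tendsto_principal.2 (Eventually.of_forall huX))
  obtain ⟨ψ, hψ, hψq⟩ := hq.tendsto_subseq
  have hqX : q ∈ X := hXc.isClosed.mem_of_mapClusterPt hq (Eventually.of_forall huX)
  have hq0 : gradient h q = 0 :=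
    tendsto_nhds_unique ((hG.tendsto q).comp hψq) (hGlim.comp hψ.tendsto_atTop)
  have hqℓ : h q = ℓ :=
    tendsto_nhds_unique ((hh.tendsto q).comp hψq) (hlim.comp hψ.tendsto_atTop)
  refine ⟨q, ?_, hq⟩
  -- Otherwise `q` is a strict local maximizer, while the orbit never drops below `h q`; so the
  -- orbit hits `q` exactly, and injectivity makes it start there.
  by_contra hqM
  have h1 := eventually_nhdsWithin_iff.1 (hcrit q hq0 hqM)
  obtain ⟨k, hk⟩ := (mapClusterPt_iff_frequently.1 hq _ h1).exists
  have hkq : u k = q := by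
    by_contra hne
    have := hk hne
    linarith [hℓ k]
  have hTq : gradStep h η q = q := by simp [gradStep, hq0]
  have hxq : x = q := by
    refine hinj.iterate hX k hx hqX ?_
    rw [Function.iterate_fixed hTq]
    exact hkq
  exact hqM (hxq ▸ hxM (hxq ▸ hq0))

/-- If every critical point of a coercive function in dimension at least two is either a local
minimizer, near which a Polyak–Łojasiewicz inequality holds, or an isolated critical point and
strict local maximizer, then the set of local minimizers is connected. -/
theorem isPreconnected_localMin (hrank : 1 < Module.rank ℝ E) {h : E → ℝ} (hh : ContDiff ℝ 2 h)
    (hco : ∀ c, Bornology.IsBounded {x | h x ≤ c})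
    (hPL : ∀ a, IsLocalMin h a → ∃ K > 0, ∀ᶠ x in 𝓝 a, h x - h a ≤ K * ‖gradient h x‖ ^ 2)
    (hcrit : ∀ x, gradient h x = 0 → ¬ IsLocalMin h x →
      ∀ᶠ y in 𝓝[≠] x, h y < h x ∧ gradient h y ≠ 0) :
    IsPreconnected {x | IsLocalMin h x} := by
  set M : Set E := {x | IsLocalMin h x} with hM
  have hMcrit : ∀ x ∈ M, gradient h x = 0 := fun x hx =>
    (gradient_eq_zero_iff h x).2 (IsLocalMin.fderiv_eq_zero hx)
  set B : Set E := {x | gradient h x = 0 ∧ ¬ IsLocalMin h x} with hB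
  have hBc : B.Countable := by
    have : IsDiscrete B := by
      refine isDiscrete_iff_nhdsNE.2 fun x hx => ?_
      rw [inf_principal_eq_bot]
      filter_upwards [hcrit x hx.1 hx.2] with y hy hyB using hy.2 hyB.1
    exact (HereditarilyLindelofSpace.isLindelof B).countable_of_isDiscrete this
  have hBpath := hBc.isPathConnected_compl_of_one_lt_rank hrank
  refine isPreconnected_of_forall_pair fun a ha b hb => ?_
  obtain ⟨γ, hγ⟩ := hBpath.joinedIn a (fun h => h.2 ha) b (fun h => h.2 hb)
  -- One sublevel set contains the whole path, so a single step size serves all its points.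
  obtain ⟨c, hc⟩ := (isCompact_range γ.continuous).bddAbove_image hh.continuous.continuousOn
  have hγc : ∀ t, h (γ t) ≤ c := fun t => hc (mem_image_of_mem h (mem_range_self t))
  obtain ⟨η, hη, hdesc, hlip⟩ := exists_gradStep_descent hh (hco c)
  set X : Set E := {x | h x ≤ c} with hXdef
  have hG : Continuous (gradient h) := (contDiff_gradient hh).continuous
  have hT : Continuous (gradStep h η) := continuous_id.sub (hG.const_smul η)
  have hX : MapsTo (gradStep h η) X X := fun x hx => by
    have : 0 ≤ η / 2 * ‖gradient h x‖ ^ 2 := by positivity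
    have h2 := hdesc x hx
    rw [hXdef, mem_ofPred_eq] at hx ⊢
    linarith
  have hXc : IsCompact X :=
    Metric.isCompact_of_isClosed_isBounded (isClosed_le hh.continuous continuous_const) (hco c)
  have hinj : InjOn (gradStep h η) X := fun x hx y hy hxy => by
    have h1 : x - y = η • gradient h x - η • gradient h y := by
      have : x - η • gradient h x = y - η • gradient h y := hxy
      rw [sub_eq_sub_iff_add_eq_add] at this ⊢
      rw [this]; abel
    have h2 := hlip x y hx hy
    rw [← h1] at h2
    have h3 : ‖x - y‖ = 0 := by linarith [norm_nonneg (x - y)]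
    exact sub_eq_zero.1 (norm_eq_zero.1 h3)
  obtain ⟨P, hPc, hPM, hPfix⟩ := exists_continuousOn_limit (D := {x ∈ X | x ∉ B}) (M := M) hT hX
    (fun x hx => hx.1) (fun x hx => by simp [gradStep, hMcrit x hx])
    (fun x hx => exists_mapClusterPt_gradStep hh.continuous hη hXc hX hdesc hinj hG
      (fun y hy hyM => (hcrit y hy hyM).mono fun z hz => hz.1) hx.1
      (fun h0 => by_contra fun hn => hx.2 ⟨h0, hn⟩))
    (fun q hq r hr => by
      obtain ⟨K, hK, hKq⟩ := hPL q hq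
      have hq' : ∀ᶠ x in 𝓝 q, h q ≤ h x := hq
      exact eventually_dist_iterate_gradStep_lt hh.continuous hη hK hX hdesc hT (hMcrit q hq)
        (hq'.and hKq) hr)
  have hγD : ∀ t, γ t ∈ {x ∈ X | x ∉ B} := fun t => ⟨hγc t, hγ t⟩
  refine ⟨range (P ∘ γ), range_subset_iff.2 fun t => hPM (hγD t), ⟨0, ?_⟩, ⟨1, ?_⟩, ?_⟩
  · have := hPfix _ (hγD 0)
    simp only [Path.source] at this
    simpa using this ha
  · have := hPfix _ (hγD 1)
    simp only [Path.target] at this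
    simpa using this hb
  · exact isPreconnected_range (hPc.comp_continuous γ.continuous hγD)

/-- A critical point with negative definite second derivative is a strict local maximizer and an
isolated critical point. -/
theorem eventually_lt_of_negDef [Nontrivial E] {h : E → ℝ} (hh : ContDiff ℝ 2 h) {x : E}
    (hx : gradient h x = 0) (hneg : ∀ v, v ≠ 0 → fderiv ℝ (fderiv ℝ h) x v v < 0) :
    ∀ᶠ y in 𝓝[≠] x, h y < h x ∧ gradient h y ≠ 0 := by
  have hd : Differentiable ℝ h := hh.differentiable (by norm_num)
  have hd2 : Differentiable ℝ (fderiv ℝ h) :=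
    (hh.fderiv_right (m := 1) (by norm_num)).differentiable (by norm_num)
  set H := fderiv ℝ (fderiv ℝ h) x with hH
  obtain ⟨κ, hκ, hκH⟩ : ∃ κ > 0, ∀ v, H v v ≤ -κ * ‖v‖ ^ 2 := by
    obtain ⟨e, he, hmax⟩ := (isCompact_sphere (0 : E) 1).exists_isMaxOn
      (NormedSpace.sphere_nonempty.2 zero_le_one) (f := fun v => H v v) (by fun_prop)
    have he0 : e ≠ 0 := by
      rintro rfl
      simp at he
    refine ⟨-H e e, neg_pos.2 (hneg e he0), fun v => ?_⟩
    rcases eq_or_ne v 0 with rfl | hv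
    · simp
    have h1 : H (‖v‖⁻¹ • v) (‖v‖⁻¹ • v) ≤ H e e := hmax (by simp [norm_smul, hv])
    simp only [map_smul, smul_apply, smul_eq_mul] at h1
    have hv' : 0 < ‖v‖ := norm_pos_iff.2 hv
    rw [← mul_assoc, ← mul_inv, inv_mul_le_iff₀ (by positivity)] at h1
    linarith
  have hx0 : fderiv ℝ h x = 0 := (gradient_eq_zero_iff h x).1 hx
  have hlittle := (hasFDerivAt_iff_isLittleO.1 (hd2 x).hasFDerivAt).def (half_pos hκ)
  -- The outward derivative is negative on a punctured ball: this excludes critical points there and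
  -- makes `h` decrease away from `x`.
  have key : ∀ᶠ y in 𝓝 x, y ≠ x → fderiv ℝ h y (y - x) < 0 := by
    filter_upwards [hlittle] with y hy hne
    rw [hx0, sub_zero, ← hH] at hy
    have h1 := (fderiv ℝ h y - H (y - x)).le_of_opNorm_le hy (y - x)
    rw [Real.norm_eq_abs] at h1
    have h2 := (abs_le.1 h1).2
    have h3 := hκH (y - x)
    have h4 : 0 < ‖y - x‖ := norm_pos_iff.2 (sub_ne_zero.2 hne)
    have h5 : 0 < κ * (‖y - x‖ * ‖y - x‖) := by positivity
    simp only [sub_apply] at h2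
    nlinarith
  obtain ⟨r, hr, hball⟩ := Metric.eventually_nhds_iff.1 key
  refine eventually_nhdsWithin_iff.2 ?_
  filter_upwards [Metric.ball_mem_nhds x hr] with y hy hne
  rw [Metric.mem_ball] at hy
  refine ⟨?_, fun h0 => ?_⟩
  · have hline : ∀ t : ℝ, HasDerivAt (fun t : ℝ => h (x + t • (y - x)))
        (fderiv ℝ h (x + t • (y - x)) (y - x)) t := fun t =>
      (hd _).hasFDerivAt.comp_hasDerivAt t
        (by simpa using ((hasDerivAt_id t).smul_const (y - x)).const_add x)
    obtain ⟨t, ht, hts⟩ := exists_hasDerivAt_eq_slope (fun t : ℝ => h (x + t • (y - x)))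
      (fun t => fderiv ℝ h (x + t • (y - x)) (y - x)) zero_lt_one
      (fun t _ => (hline t).continuousAt.continuousWithinAt) (fun t _ => hline t)
    have hpos : 0 < ‖y - x‖ := norm_pos_iff.2 (sub_ne_zero.2 hne)
    have h1 := hball (y := x + t • (y - x)) (by
      rw [dist_eq_norm, add_sub_cancel_left, norm_smul, Real.norm_of_nonneg ht.1.le]
      rw [dist_eq_norm] at hy
      nlinarith [ht.2])
      (by simpa using ⟨ht.1.ne', sub_ne_zero.2 hne⟩)
    rw [add_sub_cancel_left, map_smul, smul_eq_mul, hts] at h1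
    simp only [one_smul, add_sub_cancel, zero_smul, add_zero, sub_zero, div_one] at h1
    have := neg_of_mul_neg_right h1 ht.1.le
    linarith
  · have := hball hy hne
    rw [(gradient_eq_zero_iff h y).1 h0] at this
    simp at this

end GradientDescent

/-! ### From pointwise to global Lipschitz bounds -/

/-- A function on a convex set that is pointwise Lipschitz with constant `k` near each point is
`k`-Lipschitz. -/
theorem sub_le_of_eventually_abs_sub_le {V : Type*} [NormedAddCommGroup V] [NormedSpace ℝ V]
    {Θ : Set V} (hΘ : Convex ℝ Θ) {F : V → ℝ} {k : ℝ}
    (hF : ∀ θ ∈ Θ, ∀ᶠ θ' in 𝓝[Θ] θ, |F θ' - F θ| ≤ k * ‖θ' - θ‖) {a b : V} (ha : a ∈ Θ)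
    (hb : b ∈ Θ) : F b - F a ≤ k * ‖b - a‖ := by
  set γ : ℝ → V := fun t => a + t • (b - a) with hγ
  have hγc : Continuous γ := by fun_prop
  have hγΘ : MapsTo γ (Icc 0 1) Θ := fun t ht => hΘ.add_smul_sub_mem ha hb ht
  have hγs : ∀ s t, γ s - γ t = (s - t) • (b - a) := fun s t => by
    simp only [hγ, sub_smul]; abel
  have hφ : ∀ t ∈ Icc (0 : ℝ) 1, ∀ᶠ s in 𝓝[Icc 0 1] t,
      |F (γ s) - F (γ t)| ≤ k * ‖b - a‖ * |s - t| := fun t ht => by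
    have h1 : Tendsto γ (𝓝[Icc 0 1] t) (𝓝[Θ] (γ t)) :=
      hγc.continuousWithinAt.tendsto_nhdsWithin hγΘ
    filter_upwards [h1.eventually (hF _ (hγΘ ht))] with s hs
    rw [hγs, norm_smul, Real.norm_eq_abs] at hs
    linarith
  have hcont : ContinuousOn (fun t => F (γ t)) (Icc 0 1) := fun t ht => by
    have h1 : Tendsto (fun s => k * ‖b - a‖ * |s - t|) (𝓝[Icc 0 1] t) (𝓝 0) := by
      have : Continuous fun s => k * ‖b - a‖ * |s - t| := by fun_prop
      simpa using (this.tendsto t).mono_left nhdsWithin_le_nhds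
    refine tendsto_iff_norm_sub_tendsto_zero.2 ?_
    exact squeeze_zero' (Eventually.of_forall fun s => norm_nonneg _) (hφ t ht) h1
  -- Bounding right slopes suffices, so the neighbourhoods on which `hF` holds need not be uniform
  -- in `θ`.
  have := image_le_of_liminf_slope_right_le_deriv_boundary (a := 0) (b := 1)
    (f := fun t => F (γ t)) (B := fun t => F a + k * ‖b - a‖ * t) (B' := fun _ => k * ‖b - a‖)
    hcont (by simp [hγ]) (by fun_prop)
    (fun t _ => by
      simpa using (((hasDerivAt_id t).const_mul (k * ‖b - a‖)).const_add (F a)).hasDerivWithinAt)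
    (fun t ht r hr => by
      have h1 : 𝓝[>] t ≤ 𝓝[Icc 0 1] t := by
        rw [← nhdsWithin_Ioc_eq_nhdsGT ht.2]
        exact nhdsWithin_mono _ (Ioc_subset_Icc_self.trans (Icc_subset_Icc_left ht.1))
      refine Eventually.frequently ?_
      filter_upwards [h1 (hφ t ⟨ht.1, ht.2.le⟩), self_mem_nhdsWithin] with s hs hst
      rw [mem_Ioi] at hst
      rw [slope_def_field, div_lt_iff₀ (sub_pos.2 hst)]
      simp only [abs_of_pos (sub_pos.2 hst)] at hs
      have h3 := mul_lt_mul_of_pos_right hr (sub_pos.2 hst)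
      linarith [le_abs_self (F (γ s) - F (γ t))])
    (right_mem_Icc.2 zero_le_one)
  simp only [hγ, one_smul, add_sub_cancel, mul_one] at this
  linarith

/-! ### PL° and connectedness of the argmin -/

variable {m d : ℕ}

theorem PLCirc.eventually_le {μ : ℝ} {h : EuclideanSpace ℝ (Fin d) → ℝ} (hP : PLCirc μ h)
    {a : EuclideanSpace ℝ (Fin d)} (ha : IsLocalMin h a) :
    ∀ᶠ x in 𝓝 a, (h x - h a ≤ (2 * μ)⁻¹ * ‖gradient h x‖ ^ 2) ∧
      (gradient h x = 0 → h x ≤ h a) := by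
  obtain ⟨-, -, ⟨N, hN, -⟩, -⟩ := hP
  obtain ⟨⟨ho, hsub, hle⟩, -⟩ := hN a ha
  have haN := hsub (mem_connectedComponentIn (show a ∈ localMinima h from ha))
  filter_upwards [ho.mem_nhds haN] with x hx
  refine ⟨hle x hx a haN, fun h0 => ?_⟩
  have := hle x hx a haN
  simp only [h0, norm_zero] at this
  linarith

/-- In dimension at least two, the minimizers of a coercive function satisfying the PL° condition
form a connected set. -/
theorem PLCirc.isPreconnected_argmin {μ : ℝ} {h : EuclideanSpace ℝ (Fin d) → ℝ}
    (hP : PLCirc μ h) (hd : 2 ≤ d) (hco : ∀ c, Bornology.IsBounded {x | h x ≤ c})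
    (hne : {x | ∀ z, h x ≤ h z}.Nonempty) : IsPreconnected {x | ∀ z, h x ≤ h z} := by
  have hrank : 1 < Module.rank ℝ (EuclideanSpace ℝ (Fin d)) := by
    rw [← Module.finrank_eq_rank, finrank_euclideanSpace_fin]
    exact_mod_cast hd
  have : Nontrivial (EuclideanSpace ℝ (Fin d)) :=
    (rank_pos_iff_nontrivial (R := ℝ)).1 (zero_lt_one.trans hrank)
  obtain ⟨hμ, hC, ⟨N, hN, hneg⟩, -⟩ := id hP
  have hM : IsPreconnected {x | IsLocalMin h x} := by
    refine isPreconnected_localMin hrank hC hco (fun a ha => ⟨(2 * μ)⁻¹, by positivity,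
      (hP.eventually_le ha).mono fun x hx => hx.1⟩) fun x hx hxM => ?_
    -- A critical point inside some `N C` minimizes `h` over that open set, so one that is not a
    -- local minimizer lies outside every `N C`, where negative definiteness is assumed.
    refine eventually_lt_of_negDef hC hx (hneg x (fun hxN => ?_) hx)
    simp only [mem_iUnion] at hxN
    obtain ⟨a, ha, hxa⟩ := hxN
    obtain ⟨⟨ho, -, hle⟩, -⟩ := hN a ha
    refine hxM ?_
    filter_upwards [ho.mem_nhds hxa] with z hz
    have := hle x hxa z hz
    simp only [hx, norm_zero] at this
    linarith
  have hconst : ∀ x ∈ {x | IsLocalMin h x}, ∀ y ∈ {x | IsLocalMin h x}, h x = h y := by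
    intro x hx y hy
    refine hM.induction₂ (fun x y => h x = h y) (fun a ha => ?_)
      (fun a b c _ _ _ hab hbc => hab.trans hbc) (fun a b _ _ hab => hab.symm) hx hy
    have ha' : ∀ᶠ x in 𝓝 a, h a ≤ h x := ha
    filter_upwards [nhdsWithin_le_nhds (hP.eventually_le ha), nhdsWithin_le_nhds ha',
      self_mem_nhdsWithin] with z hz hz' hzM
    exact le_antisymm hz' (hz.2 ((gradient_eq_zero_iff h z).2 (IsLocalMin.fderiv_eq_zero hzM)))
  obtain ⟨s, hs⟩ := hne
  convert hM using 1
  ext x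
  refine ⟨fun hx => Eventually.of_forall hx, fun hx z => ?_⟩
  rw [hconst x hx s (Eventually.of_forall hs)]
  exact hs z

/-! ### Consequences of the regularity assumptions -/

variable {Θ : Set (EuclideanSpace ℝ (Fin m))}
  {f g : EuclideanSpace ℝ (Fin m) → EuclideanSpace ℝ (Fin d) → ℝ} {μ Lf1 Lg2 : ℝ≥0}

theorem UpperRegular.abs_sub_le (hf : UpperRegular Θ f Lf1) {θ θ' : EuclideanSpace ℝ (Fin m)}
    (hθ : θ ∈ Θ) (hθ' : θ' ∈ Θ) (x x' : EuclideanSpace ℝ (Fin d)) :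
    |f θ x - f θ' x'| ≤ Lf1 * (‖θ - θ'‖ + ‖x - x'‖) := by
  have h1 := hf.lipschitz.dist_le_mul (WithLp.toLp 2 (θ, x)) hθ (WithLp.toLp 2 (θ', x')) hθ'
  rw [Real.dist_eq, dist_eq_norm, WithLp.prod_norm_eq_of_L2] at h1
  refine h1.trans (mul_le_mul_of_nonneg_left ?_ Lf1.2)
  change √(‖θ - θ'‖ ^ 2 + ‖x - x'‖ ^ 2) ≤ _
  refine Real.sqrt_le_iff.2 ⟨by positivity, ?_⟩
  nlinarith [mul_nonneg (norm_nonneg (θ - θ')) (norm_nonneg (x - x'))]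

theorem UpperRegular.continuous (hf : UpperRegular Θ f Lf1) {θ : EuclideanSpace ℝ (Fin m)}
    (hθ : θ ∈ Θ) : Continuous (f θ) :=
  (LipschitzWith.of_dist_le_mul (K := Lf1) fun x y => by
    simpa [Real.dist_eq, dist_eq_norm] using hf.abs_sub_le hθ hθ x y).continuous

theorem isCompact_solSet (hg : LowerRegular Θ g Lg2) {θ : EuclideanSpace ℝ (Fin m)}
    (hθ : θ ∈ Θ) (hc : Continuous (g θ)) : IsCompact (solSet g θ) := by
  obtain ⟨μqg, D, -, -, hq⟩ := hg.quadratic_growth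
  refine (isCompact_closedBall 0 D).of_isClosed_subset ?_ (hq θ hθ).1
  have : solSet g θ = ⋂ z, {x | g θ x ≤ g θ z} := by
    ext x; simp [solSet]
  rw [this]
  exact isClosed_iInter fun z => isClosed_le hc continuous_const

/-- Quadratic growth outside a ball containing `S(θ)` supplies the coercivity that gradient descent
needs. -/
theorem LowerRegular.isBounded_sublevel (hg : LowerRegular Θ g Lg2)
    {θ : EuclideanSpace ℝ (Fin m)} (hθ : θ ∈ Θ) (c : ℝ) :
    Bornology.IsBounded {x | g θ x ≤ c} := by
  obtain ⟨μqg, D, hμ, hD, hq⟩ := hg.quadratic_growth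
  obtain ⟨hsub, hgr⟩ := hq θ hθ
  obtain ⟨s, hs⟩ := hg.min_attained θ hθ
  set A := √(2 * |c - g θ s| / μqg) with hA
  refine (Metric.isBounded_closedBall (x := 0) (r := A + D)).subset fun x hx => ?_
  rw [mem_closedBall_zero_iff]
  by_cases hxD : D ≤ ‖x‖
  · have h1 := hgr x hxD s hs
    have h2 : ‖x‖ - D ≤ Metric.infDist x (solSet g θ) := by
      refine (Metric.le_infDist ⟨s, hs⟩).2 fun y hy => ?_
      have hy' := mem_closedBall_zero_iff.1 (hsub hy)
      rw [dist_eq_norm]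
      linarith [norm_sub_norm_le x y]
    have h3 : Metric.infDist x (solSet g θ) ≤ A := by
      refine Real.le_sqrt_of_sq_le ?_
      rw [le_div_iff₀ hμ]
      have hx' : g θ x ≤ c := hx
      linarith [le_abs_self (c - g θ s)]
    linarith
  · linarith [Real.sqrt_nonneg (2 * |c - g θ s| / μqg), not_le.1 hxD]

/-- The gradient of `g θ` vanishes at `y`, so only its variation in the parameter remains. -/
theorem LowerRegular.norm_gradient_le (hg : LowerRegular Θ g Lg2)
    {θ θ' : EuclideanSpace ℝ (Fin m)} (hθ : θ ∈ Θ) (hθ' : θ' ∈ Θ)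
    {y : EuclideanSpace ℝ (Fin d)} (hy : y ∈ solSet g θ) :
    ‖gradient (g θ') y‖ ≤ Lg2 * ‖θ' - θ‖ := by
  have h1 := (hg.smooth θ hθ y hy).dist_le_mul θ' hθ' θ hθ
  have h2 : gradient (g θ) y = 0 :=
    (gradient_eq_zero_iff _ _).2 (IsLocalMin.fderiv_eq_zero (Eventually.of_forall hy))
  simpa [dist_eq_norm, h2] using h1

theorem LowerRegular.tendsto_joint (hg : LowerRegular Θ g Lg2) {θ : EuclideanSpace ℝ (Fin m)}
    (hθ : θ ∈ Θ) {l : Filter (EuclideanSpace ℝ (Fin m))} (hl : l ≤ 𝓝 θ)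
    {s : EuclideanSpace ℝ (Fin m) → EuclideanSpace ℝ (Fin d)} {y : EuclideanSpace ℝ (Fin d)}
    (hs : Tendsto s l (𝓝 y)) : Tendsto (fun η => g η (s η)) l (𝓝 (g θ y)) := by
  have h1 : ContinuousAt (joint g) (WithLp.toLp 2 (θ, y)) :=
    (hg.contDiff _ (show θ ∈ Θ from hθ)).continuousAt
  have h2 : Tendsto (fun η => WithLp.toLp 2 (η, s η)) l (𝓝 (WithLp.toLp 2 (θ, y))) :=
    ((WithLp.prod_continuous_toLp 2 _ _).tendsto (θ, y)).comp
      ((tendsto_id.mono_left hl).prodMk_nhds hs)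
  exact h1.tendsto.comp h2

/-- Selections of minimizers converge to minimizers along ultrafilters. -/
theorem LowerRegular.exists_tendsto (hg : LowerRegular Θ g Lg2) {θ : EuclideanSpace ℝ (Fin m)}
    (hθ : θ ∈ Θ) {U : Ultrafilter (EuclideanSpace ℝ (Fin m))} (hU : (U : Filter _) ≤ 𝓝[Θ] θ)
    {s : EuclideanSpace ℝ (Fin m) → EuclideanSpace ℝ (Fin d)} (hs : ∀ η ∈ Θ, s η ∈ solSet g η) :
    ∃ y ∈ solSet g θ, Tendsto s U (𝓝 y) := by
  obtain ⟨μqg, D, -, -, hq⟩ := hg.quadratic_growth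
  have hUΘ : ∀ᶠ η in (U : Filter _), η ∈ Θ := hU self_mem_nhdsWithin
  obtain ⟨y, -, hy⟩ := (isCompact_closedBall (0 : EuclideanSpace ℝ (Fin d)) D).ultrafilter_le_nhds
    (U.map s) (le_principal_iff.2 (hUΘ.mono fun η hη => (hq η hη).1 (hs η hη)))
  have hy' : Tendsto s U (𝓝 y) := hy
  have hl := hU.trans nhdsWithin_le_nhds
  refine ⟨y, fun z => ?_, hy'⟩
  exact le_of_tendsto_of_tendsto (hg.tendsto_joint hθ hl hy')
    (hg.tendsto_joint hθ hl tendsto_const_nhds) (hUΘ.mono fun η hη => hs η hη z)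

/-! ### Stability of the solution sets -/

/-- Error bound for the lower-level problems, locally uniform in the parameter. -/
theorem exists_local_error_bound (hPL : ∀ θ ∈ Θ, PLCirc (μ : ℝ) (g θ))
    (hg : LowerRegular Θ g Lg2) {θ : EuclideanSpace ℝ (Fin m)} (hθ : θ ∈ Θ)
    (x : EuclideanSpace ℝ (Fin d)) {ε : ℝ} (hε : 0 < ε) :
    ∃ δ > 0, ∀ᶠ η in 𝓝[Θ] θ, ∀ y ∈ Metric.ball x δ, ∀ p ∈ Metric.ball x δ, p ∈ solSet g η →
      Metric.infDist y (solSet g η) = ‖y - p‖ →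
        (μ - ε) * ‖y - p‖ ≤ ‖gradient (g η) y‖ := by
  have h1 : ∀ᶠ q in 𝓝[Θ] θ ×ˢ 𝓝 x,
      dist (fderiv ℝ (fderiv ℝ (g q.1)) q.2) (fderiv ℝ (fderiv ℝ (g θ)) x) < ε / 2 := by
    have h2 := hg.hessian_continuous (θ, x) ⟨hθ, mem_univ x⟩
    rw [ContinuousWithinAt, nhdsWithin_prod_eq, nhdsWithin_univ] at h2
    exact Metric.tendsto_nhds.1 h2 (ε / 2) (half_pos hε)
  obtain ⟨pa, hpa, pb, hpb, hab⟩ := eventually_prod_iff.1 h1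
  obtain ⟨δ, hδ, hball⟩ := Metric.eventually_nhds_iff.1 hpb
  refine ⟨δ, hδ, ?_⟩
  filter_upwards [hpa, self_mem_nhdsWithin] with η hη hηΘ y hy p hp hpS hdist
  have hP := hPL η hηΘ
  rw [norm_gradient_eq]
  refine mul_norm_sub_le_norm_fderiv hP.2.1 hP.1 (S := solSet g η) rfl hpS
    ((hP.eventually_le (Eventually.of_forall hpS)).mono fun z hz => ?_) hdist
    (convex_ball x δ) hp hy fun z hz => ?_
  · rw [← norm_gradient_eq]; exact hz.1
  · refine (dist_eq_norm (fderiv ℝ (fderiv ℝ (g η)) z)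
      (fderiv ℝ (fderiv ℝ (g η)) p)).symm.trans_le ?_
    have h3 := hab hη (hball hz)
    have h4 := hab hη (hball hp)
    have := dist_triangle_right (fderiv ℝ (fderiv ℝ (g η)) z) (fderiv ℝ (fderiv ℝ (g η)) p)
      (fderiv ℝ (fderiv ℝ (g θ)) x)
    simp only at h3 h4
    linarith

/-- Lower semicontinuity of the solution map. -/
theorem tendsto_infDist_solSet (hd : 2 ≤ d) (hPL : ∀ θ ∈ Θ, PLCirc (μ : ℝ) (g θ))
    (hg : LowerRegular Θ g Lg2) {θ : EuclideanSpace ℝ (Fin m)} (hθ : θ ∈ Θ)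
    {U : Ultrafilter (EuclideanSpace ℝ (Fin m))} (hU : (U : Filter _) ≤ 𝓝[Θ] θ)
    {x : EuclideanSpace ℝ (Fin d)} (hx : x ∈ solSet g θ) :
    Tendsto (fun η => Metric.infDist x (solSet g η)) U (𝓝 0) := by
  have hμ : (0 : ℝ) < μ := (hPL θ hθ).1
  have hUΘ : ∀ᶠ η in (U : Filter _), η ∈ Θ := hU self_mem_nhdsWithin
  have hUθ : Tendsto (fun η => ‖θ - η‖) U (𝓝 0) := by
    have : Continuous fun η => ‖θ - η‖ := by fun_prop
    simpa using (this.tendsto θ).mono_left (hU.trans nhdsWithin_le_nhds)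
  choose! s hs using hg.min_attained
  obtain ⟨y, hy, hsy⟩ := hg.exists_tendsto hθ hU hs
  have hyZ : Tendsto (fun η => Metric.infDist y (solSet g η)) U (𝓝 0) := by
    refine squeeze_zero' (Eventually.of_forall fun _ => Metric.infDist_nonneg) ?_
      (tendsto_iff_dist_tendsto_zero.1 hsy)
    filter_upwards [hUΘ] with η hη
    rw [dist_comm]
    exact Metric.infDist_le_dist_of_mem (hs η hη)
  have hconn : IsPreconnected (solSet g θ) :=
    (hPL θ hθ).isPreconnected_argmin hd (hg.isBounded_sublevel hθ) (hg.min_attained θ hθ)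
  have key : ∀ a ∈ solSet g θ, ∃ r > 0, ∀ b ∈ Metric.ball a r, ∀ c ∈ Metric.ball a r,
      c ∈ solSet g θ → Tendsto (fun η => Metric.infDist b (solSet g η)) U (𝓝 0) →
        Tendsto (fun η => Metric.infDist c (solSet g η)) U (𝓝 0) := by
    intro a ha
    obtain ⟨δ, hδ, hev⟩ := exists_local_error_bound hPL hg hθ a (half_pos hμ)
    -- The point `p` of `S(η)` nearest to `c` is within `δ / 5 + 2 * δ / 5` of `c`, hence within `4
    -- * δ / 5` of `a`, so the error bound applies.
    refine ⟨δ / 5, by positivity, fun b hb c hc hcS hbZ => ?_⟩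
    rw [Metric.mem_ball] at hb hc
    refine squeeze_zero' (Eventually.of_forall fun _ => Metric.infDist_nonneg) ?_
      (by simpa using hUθ.const_mul (2 / (μ : ℝ) * Lg2))
    filter_upwards [hU hev, hUΘ, hbZ.eventually_lt_const (show (0 : ℝ) < δ / 5 by positivity)]
      with η h1 hη h2
    obtain ⟨p, hpS, hp⟩ := (isCompact_solSet hg hη (hPL η hη).2.1.continuous).exists_infDist_eq_dist
      ⟨s η, hs η hη⟩ c
    have h3 := Metric.infDist_le_infDist_add_dist (s := solSet g η) (x := c) (y := b)
    have h4 := dist_triangle_right c b a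
    have h5 := dist_triangle p c a
    rw [dist_comm p c, ← hp] at h5
    rw [dist_eq_norm] at hp
    have h6 := h1 c (by rw [Metric.mem_ball]; linarith) p (by rw [Metric.mem_ball]; linarith) hpS hp
    have h7 := hg.norm_gradient_le hθ hη hcS
    rw [norm_sub_rev] at h7
    rw [hp]
    have h8 : (μ : ℝ) / 2 * ‖c - p‖ ≤ Lg2 * ‖θ - η‖ := by linarith
    calc ‖c - p‖ = 2 / (μ : ℝ) * ((μ : ℝ) / 2 * ‖c - p‖) := by field_simp
      _ ≤ 2 / (μ : ℝ) * (Lg2 * ‖θ - η‖) := mul_le_mul_of_nonneg_left h8 (by positivity)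
      _ = _ := by ring
  refine (hconn.induction₂ (fun a b =>
    Tendsto (fun η => Metric.infDist a (solSet g η)) U (𝓝 0) ↔
      Tendsto (fun η => Metric.infDist b (solSet g η)) U (𝓝 0)) (fun a ha => ?_)
    (fun _ _ _ _ _ _ h1 h2 => h1.trans h2) (fun _ _ _ _ h1 => h1.symm) hy hx).1 hyZ
  obtain ⟨r, hr, hkey⟩ := key a ha
  filter_upwards [nhdsWithin_le_nhds (Metric.ball_mem_nhds a hr), self_mem_nhdsWithin] with b hb hbS
  exact ⟨hkey a (Metric.mem_ball_self hr) b hb hbS, hkey b hb a (Metric.mem_ball_self hr) ha⟩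

/-! ### Lipschitz continuity of the hyper-objective -/

theorem isGreatest_Fmax (hPL : ∀ θ ∈ Θ, PLCirc (μ : ℝ) (g θ)) (hf : UpperRegular Θ f Lf1)
    (hg : LowerRegular Θ g Lg2) {θ : EuclideanSpace ℝ (Fin m)} (hθ : θ ∈ Θ) :
    IsGreatest (f θ '' solSet g θ) (Fmax f g θ) :=
  ((isCompact_solSet hg hθ (hPL θ hθ).2.1.continuous).image (hf.continuous hθ)).isGreatest_sSup
    ((hg.min_attained θ hθ).image _)

/-- Comparison of the hyper-objective at two parameters, through an error bound at a point where
the first maximum is attained. -/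
theorem Fmax_sub_le (hPL : ∀ θ ∈ Θ, PLCirc (μ : ℝ) (g θ)) (hf : UpperRegular Θ f Lf1)
    (hg : LowerRegular Θ g Lg2) {θ η : EuclideanSpace ℝ (Fin m)} (hθ : θ ∈ Θ) (hη : η ∈ Θ) {c : ℝ}
    (hc : 0 < c) {y p : EuclideanSpace ℝ (Fin d)} (hy : y ∈ solSet g θ)
    (hyF : f θ y = Fmax f g θ) (hp : p ∈ solSet g η)
    (hle : c * ‖y - p‖ ≤ ‖gradient (g η) y‖) :
    Fmax f g θ - Fmax f g η ≤ Lf1 * (1 + Lg2 / c) * ‖η - θ‖ := by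
  have h1 := (isGreatest_Fmax hPL hf hg hη).2 (mem_image_of_mem _ hp)
  have h2 := (le_abs_self _).trans (hf.abs_sub_le hθ hη y p)
  have h3 := hg.norm_gradient_le hθ hη hy
  have h4 : ‖y - p‖ ≤ Lg2 / c * ‖η - θ‖ := by
    rw [div_mul_eq_mul_div, le_div_iff₀ hc]
    linarith
  rw [norm_sub_rev θ η] at h2
  have h5 := mul_le_mul_of_nonneg_left h4 Lf1.2
  rw [← hyF]
  change (Lf1 : ℝ) * _ ≤ Lf1 * _ at h5
  linarith

/-- The two directions differ. Maximizers at `η` accumulate in `S(θ)` by compactness, but a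
maximizer at `θ` is approached by `S(η)` only through lower semicontinuity, hence connectedness.
Ultrafilters make selections converge without subsequences. -/
theorem eventually_abs_Fmax_sub_le (hd : 2 ≤ d) (hPL : ∀ θ ∈ Θ, PLCirc (μ : ℝ) (g θ))
    (hf : UpperRegular Θ f Lf1) (hg : LowerRegular Θ g Lg2) {ε : ℝ} (hε : 0 < ε) (hεμ : ε < μ)
    {θ : EuclideanSpace ℝ (Fin m)} (hθ : θ ∈ Θ) :
    ∀ᶠ η in 𝓝[Θ] θ,
      |Fmax f g η - Fmax f g θ| ≤ Lf1 * (1 + Lg2 / (μ - ε)) * ‖η - θ‖ := by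
  refine mem_iff_ultrafilter.2 fun U hU => ?_
  have hUΘ : ∀ᶠ η in (U : Filter _), η ∈ Θ := hU self_mem_nhdsWithin
  have hc : (0 : ℝ) < μ - ε := sub_pos.2 hεμ
  have hcomp : ∀ η ∈ Θ, ∀ y, ∃ p ∈ solSet g η, Metric.infDist y (solSet g η) = dist y p :=
    fun η hη y => (isCompact_solSet hg hη (hPL η hη).2.1.continuous).exists_infDist_eq_dist
      (hg.min_attained η hη) y
  have hmax : ∀ η ∈ Θ, ∃ y ∈ solSet g η, f η y = Fmax f g η := fun η hη =>
    (isGreatest_Fmax hPL hf hg hη).1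
  have hupper : ∀ᶠ η in (U : Filter _),
      Fmax f g η - Fmax f g θ ≤ Lf1 * (1 + Lg2 / (μ - ε)) * ‖η - θ‖ := by
    choose! s hs hsF using hmax
    obtain ⟨y, hy, hsy⟩ := hg.exists_tendsto hθ hU hs
    obtain ⟨δ, hδ, hev⟩ := exists_local_error_bound hPL hg hθ y hε
    filter_upwards [hUΘ, hsy.eventually (Metric.ball_mem_nhds y (half_pos hδ))] with η hη h1
    obtain ⟨p, hpS, hp⟩ := hcomp θ hθ (s η)
    have h2 := Metric.infDist_le_dist_of_mem (x := s η) hy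
    have h3 := dist_triangle_left p y (s η)
    have h1' : dist (s η) y < δ / 2 := h1
    rw [norm_sub_rev]
    refine Fmax_sub_le hPL hf hg hη hθ hc (hs η hη) (hsF η hη) hpS ?_
    -- Here the error bound is used for `g θ` itself, at the moving point `s η`.
    exact hev.self_of_nhdsWithin hθ (s η) (by rw [Metric.mem_ball]; linarith) p
      (by rw [Metric.mem_ball]; linarith) hpS (by rw [hp, dist_eq_norm])
  have hlower : ∀ᶠ η in (U : Filter _),
      Fmax f g θ - Fmax f g η ≤ Lf1 * (1 + Lg2 / (μ - ε)) * ‖η - θ‖ := by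
    obtain ⟨y, hy, hyF⟩ := hmax θ hθ
    obtain ⟨δ, hδ, hev⟩ := exists_local_error_bound hPL hg hθ y hε
    filter_upwards [hUΘ, hU hev,
      (tendsto_infDist_solSet hd hPL hg hθ hU hy).eventually_lt_const hδ] with η hη h1 h2
    obtain ⟨p, hpS, hp⟩ := hcomp η hη y
    refine Fmax_sub_le hPL hf hg hθ hη hc hy hyF hpS ?_
    exact h1 y (Metric.mem_ball_self hδ) p
      (by rw [Metric.mem_ball, dist_comm, ← hp]; exact h2) hpS (by rw [hp, dist_eq_norm])
  filter_upwards [hupper, hlower] with η h1 h2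
  rw [abs_le]
  constructor <;> linarith

end Bilevel

theorem mainTheorem2 (m d : ℕ) (hd : 2 ≤ d)
    (Θ : Set (EuclideanSpace ℝ (Fin m))) (hΘ_compact : IsCompact Θ) (hΘ_convex : Convex ℝ Θ)
    (f g : EuclideanSpace ℝ (Fin m) → EuclideanSpace ℝ (Fin d) → ℝ)
    (μ Lf1 Lg2 : ℝ≥0)
    (hPL : ∀ θ ∈ Θ, Bilevel.PLCirc (μ : ℝ) (g θ))
    (hf : Bilevel.UpperRegular Θ f Lf1)
    (hg : Bilevel.LowerRegular Θ g Lg2) :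
    (∀ θ ∈ Θ, IsGreatest (f θ '' Bilevel.solSet g θ) (Bilevel.Fmax f g θ)) ∧
      LipschitzOnWith (Lf1 * (1 + Lg2 / μ)) (Bilevel.Fmax f g) Θ := by
  refine ⟨fun θ hθ => Bilevel.isGreatest_Fmax hPL hf hg hθ, ?_⟩
  have key : ∀ a ∈ Θ, ∀ b ∈ Θ, Bilevel.Fmax f g b - Bilevel.Fmax f g a
      ≤ Lf1 * (1 + Lg2 / μ) * ‖b - a‖ := by
    intro a ha b hb
    have hμ : (0 : ℝ) < μ := (hPL a ha).1
    have hlim : Tendsto (fun ε : ℝ => (Lf1 : ℝ) * (1 + Lg2 / (μ - ε)) * ‖b - a‖) (𝓝[>] 0)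
        (𝓝 (Lf1 * (1 + Lg2 / μ) * ‖b - a‖)) := by
      have : ContinuousAt (fun ε : ℝ => (Lf1 : ℝ) * (1 + Lg2 / (μ - ε)) * ‖b - a‖) 0 := by
        have : (μ : ℝ) - 0 ≠ 0 := by simpa using hμ.ne'
        fun_prop (disch := assumption)
      simpa using this.tendsto.mono_left (nhdsWithin_le_nhds (s := Ioi 0))
    refine ge_of_tendsto hlim ?_
    filter_upwards [Ioo_mem_nhdsGT hμ] with ε hε
    exact Bilevel.sub_le_of_eventually_abs_sub_le hΘ_convex
      (fun θ hθ => Bilevel.eventually_abs_Fmax_sub_le hd hPL hf hg hε.1 hε.2 hθ) ha hb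
  refine LipschitzOnWith.of_dist_le_mul fun a ha b hb => ?_
  rw [Real.dist_eq, dist_eq_norm, abs_le]
  have h1 := key a ha b hb
  have h2 := key b hb a ha
  rw [norm_sub_rev b a] at h1
  push_cast
  constructor <;> linarith
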